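/- Let $\Theta'=\{(r',s')\in[0,1]^2 : 0<r'+s'\le 1\}$. For $(r',s')\in\Theta'$ let $E_{r',s'}$ be the one-dimensional probabilistic cellular automaton with alphabet $\{W,L,D\}$ and universe $\mathbb{Z}$ in which, given a configuration $\eta\in\{W,L,D\}^{\mathbb{Z}}$, all cells are updated simultaneously and independently, the cell $x$ taking the new state $b$ with probability $\widehat\varphi(\eta(x),\eta(x+1),b)$, where $\widehat\varphi$ is symmetric in its first two arguments and - $\widehat\varphi(W,W,\cdot)$ is $2s'-s'^2$ at $W$, $(1-s')^2$ at $L$, $0$ at $D$; - $\widehat\varphi(W,L,\cdot)$ is $1-r'+r's'$ at $W$, $r'-r's'$ at $L$, $0$ at $D$; - $\widehat\varphi(L,L,\cdot)$ is $1-r'^2$ at $W$, $r'^2$ at $L$, $0$ at $D$; - $\widehat\varphi(W,D,\cdot)$ is $2s'-s'^2$ at $W$, $r'(1-s')$ at $L$, $(1-s')(1-r'-s')$ at $D$; - $\widehat\varphi(L,D,\cdot)$ is $1-r'+r's'$ at $W$, $r'^2$ at $L$, $r'(1-r'-s')$ at $D$; - $\widehat\varphi(D,D,\cdot)$ is $2s'-s'^2$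 at $W$, $r'^2$ at $L$, $(1-r'-s')(1+r'-s')$ at $D$. A probability measure $\mu$ on $\{W,L,D\}^{\mathbb{Z}}$ (with the $\sigma$-algebra generated by the cylinder sets) is stationary for $E_{r',s'}$ if $E_{r',s'}\mu=\mu$, where $E_{r',s'}\mu$ is the law of the updated configuration when the initial one has law $\mu$; it is translation-invariant if it is invariant under all maps $\eta\mapsto\eta(\cdot+y)$, $y\in\mathbb{Z}$, and reflection-invariant if it is invariant under $\eta\mapsto\eta(-\,\cdot)$. **Theorem.** There exist $\epsilon_1,\epsilon_2\in(0,1)$ such that the following holds. Let $(r',s')\in\Theta'$ satisfy at least one of the conditions (B1) $r'\le\epsilon_1$, $s'\le\epsilon_2$ and $$\frac{3(2s'-s'^2)^2}{2}+\frac{8(2s'-s'^2)r'}{1-s'}+\frac{11r'^2}{2(1-s')^2}\ \ge\ \frac{2r'}{1-s'}+\frac{9(2s'-s'^2)^3}{2}+\frac{16(2s'-s'^2)^2r'}{1-s'}+\frac{43(2s'-s'^2)r'^2}{2(1-s')^2}+\frac{5r'^3}{(1-s')^3};$$ (B2) $s'=0$ and $r'>0.157175$; (B3) $r'=s'\ge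 0.10883$. If $\mu$ is any translation-invariant and reflection-invariant stationary probability measure for $E_{r',s'}$, then $\mu(\{\eta:\eta(x)=D\})=0$ for every $x\in\mathbb{Z}$. -/

import Mathlib

open MeasureTheory ProbabilityTheory

/-- The alphabet `{W, L, D}` of the envelope automaton. -/
inductive Symb : Type
  | W : Symb
  | L : Symb
  | D : Symb
  deriving DecidableEq

instance instFintypeSymb : Fintype Symb where
  elems := {.W, .L, .D}
  complete := fun a => by cases a <;> decide

/-- The alphabet is finite and carries the discrete `σ`-algebra. The space `ℤ → Symb` then carries
the product `σ`-algebra, which is generated by the cylinder sets. -/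
instance instMeasurableSpaceSymb : MeasurableSpace Symb := ⊤

instance instDiscreteMeasurableSpaceSymb : DiscreteMeasurableSpace Symb := ⟨fun _ => trivial⟩

/-- A stochastic matrix `A² × A → [0,1]`: the local update rule of a one-dimensional probabilistic
cellular automaton with alphabet `A` and neighbourhood-marking set `{0, 1}`. -/
structure StochasticRule (A : Type) [Fintype A] where
  /-- `prob a₀ a₁ b` is the probability that a cell is updated to `b` when `a₀` is its own
  state and `a₁` is the state of its right neighbour. -/
  prob : A → A → A → ℝ
  prob_nonneg : ∀ a₀ a₁ b, 0 ≤ prob a₀ a₁ b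
  prob_sum : ∀ a₀ a₁, ∑ b, prob a₀ a₁ b = 1

namespace StochasticRule

variable {A : Type} [Fintype A]

/-- The distribution of the updated state of a cell. -/
noncomputable def localPMF (φ : StochasticRule A) (a₀ a₁ : A) : PMF A :=
  PMF.ofFintype (fun b => ENNReal.ofReal (φ.prob a₀ a₁ b)) (by
    rw [← ENNReal.ofReal_sum_of_nonneg (fun b _ => φ.prob_nonneg a₀ a₁ b), φ.prob_sum,
      ENNReal.ofReal_one])

variable [MeasurableSpace A] [DiscreteMeasurableSpace A]

/-- The law of the updated configuration `Fη`: all cells are updated independently, the cell `x`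
according to the rule applied to `(η x, η (x + 1))`. -/
noncomputable def updateLaw (φ : StochasticRule A) (η : ℤ → A) : Measure (ℤ → A) :=
  Measure.infinitePi fun x : ℤ => (φ.localPMF (η x) (η (x + 1))).toMeasure

instance instIsProbabilityMeasureUpdateLaw (φ : StochasticRule A) (η : ℤ → A) :
    IsProbabilityMeasure (φ.updateLaw η) := by
  unfold updateLaw; infer_instance

theorem measurable_of_pair (g : A → A → ENNReal) (i : ℤ) :
    Measurable fun η : ℤ → A => g (η i) (η (i + 1)) := by
  have hg : Measurable (Function.uncurry g) := measurable_of_countable _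
  have hp : Measurable fun η : ℤ → A => (η i, η (i + 1)) :=
    (measurable_pi_apply i).prodMk (measurable_pi_apply (i + 1))
  exact hg.comp hp

theorem measurable_updateLaw (φ : StochasticRule A) : Measurable φ.updateLaw := by
  have hgen := (generateFrom_squareCylinders (α := fun _ : ℤ => A)).symm
  have hpi : IsPiSystem
      (squareCylinders fun _ : ℤ => {s : Set A | MeasurableSet s}) :=
    isPiSystem_squareCylinders (fun _ => MeasurableSpace.isPiSystem_measurableSet)
      (fun _ => MeasurableSet.univ)
  refine Measurable.measure_of_isPiSystem_of_isProbabilityMeasure hgen hpi ?_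
  intro B hB
  obtain ⟨I, t, ht, hIt⟩ := hB
  have ht' : ∀ i, MeasurableSet (t i) := fun i => ht i (Set.mem_univ i)
  have h : ∀ η : ℤ → A, φ.updateLaw η B =
      ∏ i ∈ I, (φ.localPMF (η i) (η (i + 1))).toMeasure (t i) := by
    intro η
    rw [hIt, updateLaw, Measure.infinitePi_pi _ (fun i _ => ht' i)]
  have hm : ∀ i ∈ I, Measurable fun η : ℤ → A =>
      (φ.localPMF (η i) (η (i + 1))).toMeasure (t i) := fun i _ =>
    measurable_of_pair (fun a b => (φ.localPMF a b).toMeasure (t i)) i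
  have hprod := Finset.measurable_fun_prod I hm
  rw [funext h]
  exact hprod

/-- The probabilistic cellular automaton with local rule `φ`, as a Markov kernel on the space of
configurations. The law `Fμ` is then `μ.bind φ.pca`, and `μ` is stationary if
`Kernel.Invariant φ.pca μ`, i.e. `μ.bind φ.pca = μ`. -/
noncomputable def pca (φ : StochasticRule A) : Kernel (ℤ → A) (ℤ → A) where
  toFun := φ.updateLaw
  measurable' := φ.measurable_updateLaw

end StochasticRule

/-- The parameter space `Θ'` of the bond percolation game: `r` is the probability that an edge is
a trap, `s` the probability that it is a target. -/
def BondParams : Set (ℝ × ℝ) :=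
  {θ | θ.1 ∈ Set.Icc (0 : ℝ) 1 ∧ θ.2 ∈ Set.Icc (0 : ℝ) 1 ∧ 0 < θ.1 + θ.2 ∧ θ.1 + θ.2 ≤ 1}

/-- The update probabilities of the envelope bond automaton. -/
def bondProb (r s : ℝ) : Symb → Symb → Symb → ℝ
  | .W, .W, .W => 2 * s - s ^ 2
  | .W, .W, .L => (1 - s) ^ 2
  | .W, .W, .D => 0
  | .W, .L, .W | .L, .W, .W => 1 - r + r * s
  | .W, .L, .L | .L, .W, .L => r - r * s
  | .W, .L, .D | .L, .W, .D => 0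
  | .L, .L, .W => 1 - r ^ 2
  | .L, .L, .L => r ^ 2
  | .L, .L, .D => 0
  | .W, .D, .D | .D, .W, .D => (1 - s) * (1 - r - s)
  | .W, .D, .L | .D, .W, .L => r * (1 - s)
  | .W, .D, .W | .D, .W, .W => 2 * s - s ^ 2
  | .L, .D, .W | .D, .L, .W => 1 - r + r * s
  | .L, .D, .D | .D, .L, .D => r * (1 - r - s)
  | .L, .D, .L | .D, .L, .L => r ^ 2
  | .D, .D, .D => (1 - r - s) * (1 + r - s)
  | .D, .D, .L => r ^ 2
  | .D, .D, .W => 2 * s - s ^ 2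

/-- The local rule of the envelope bond automaton `E_{r,s}`. -/
def bondRule (r s : ℝ) (h : (r, s) ∈ BondParams) : StochasticRule Symb where
  prob := bondProb r s
  prob_nonneg := by
    obtain ⟨⟨hr0, hr1⟩, ⟨hs0, hs1⟩, -, hrs⟩ := h
    dsimp only at hr0 hr1 hs0 hs1 hrs
    intro a₀ a₁ b
    cases a₀ <;> cases a₁ <;> cases b <;> simp only [bondProb] <;>
      first
        | positivity
        | nlinarith [mul_nonneg hr0 hs0]
  prob_sum := by
    intro a₀ a₁
    have hsum : ∀ f : Symb → ℝ, ∑ b, f b = f .W + f .L + f .D := by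
      intro f
      have hu : (Finset.univ : Finset Symb) = {.W, .L, .D} := by decide
      rw [hu, Finset.sum_insert (by decide), Finset.sum_insert (by decide),
        Finset.sum_singleton, add_assoc]
    rw [hsum]
    cases a₀ <;> cases a₁ <;> simp only [bondProb] <;> ring

/-- The envelope bond automaton `E_{r,s}`. -/
noncomputable def bondPCA (r s : ℝ) (h : (r, s) ∈ BondParams) : Kernel (ℤ → Symb) (ℤ → Symb) :=
  (bondRule r s h).pca

/-- The shift `(T^y η)(x) = η(x + y)`. -/
def shiftConf (y : ℤ) (η : ℤ → Symb) : ℤ → Symb := fun x => η (x + y)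

/-- The reflection `(R η)(x) = η(-x)`. -/
def reflectConf (η : ℤ → Symb) : ℤ → Symb := fun x => η (-x)

/-- `μ(B) = μ(T^y B)` for every measurable `B` and every `y ∈ ℤ`. -/
def TranslationInvariant (μ : Measure (ℤ → Symb)) : Prop :=
  ∀ (y : ℤ) (B : Set (ℤ → Symb)), MeasurableSet B → μ B = μ (shiftConf y '' B)

/-- `μ(B) = μ(R B)` for every measurable `B`. -/
def ReflectionInvariant (μ : Measure (ℤ → Symb)) : Prop :=
  ∀ B : Set (ℤ → Symb), MeasurableSet B → μ B = μ (reflectConf '' B)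

/-- First regime: `r ≤ ε₁`, `s ≤ ε₂`, and the polynomial inequality below. -/
def RegimeB1 (ε₁ ε₂ r s : ℝ) : Prop :=
  r ≤ ε₁ ∧ s ≤ ε₂ ∧
    3 * (2 * s - s ^ 2) ^ 2 / 2 + 8 * (2 * s - s ^ 2) * r / (1 - s)
        + 11 * r ^ 2 / (2 * (1 - s) ^ 2)
      ≥ 2 * r / (1 - s) + 9 * (2 * s - s ^ 2) ^ 3 / 2
        + 16 * (2 * s - s ^ 2) ^ 2 * r / (1 - s)
        + 43 * (2 * s - s ^ 2) * r ^ 2 / (2 * (1 - s) ^ 2)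
        + 5 * r ^ 3 / (1 - s) ^ 3

/-- Second regime: no targets, and traps of probability larger than `0.157175`. -/
def RegimeB2 (r s : ℝ) : Prop := s = 0 ∧ 0.157175 < r

/-- Third regime: `r = s ≥ 0.10883`. -/
def RegimeB3 (r s : ℝ) : Prop := r = s ∧ 0.10883 ≤ r

/-! A cell becomes `D` only if it or its right neighbour is `D`. Stationarity therefore expresses
the probabilities of `D`, `WD` and `DD` through three-letter words containing `D`, and bounds that
of `LWD` in the same way. Take the weight `D + a·WD + e·DD + b·LWD`. Its change in one step is zero,
yet it is at most a linear combination of word probabilities; if every coefficient is `≤ 0`, and `<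
0` for words with middle letter `D`, then those words are null and so is `D`.

`isStationaryTriple_tripleProb` supplies the linear relations,
`IsStationaryTriple.eq_zero_of_weight` is the weight argument, and each regime then needs only
weights meeting explicit polynomial inequalities in `r` and `s`. -/

theorem sum_symb (f : Symb → ℝ) : ∑ b, f b = f .W + f .L + f .D := by
  have hu : (Finset.univ : Finset Symb) = {.W, .L, .D} := by decide
  rw [hu, Finset.sum_insert (by decide), Finset.sum_insert (by decide),
    Finset.sum_singleton, add_assoc]

/-! ### Stationarity on finite words. -/

/-- Stationarity tested on a finite-dimensional cylinder. -/
theorem measureReal_cylinder_of_invariant {A : Type} [Fintype A] [MeasurableSpace A]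
    [DiscreteMeasurableSpace A] (φ : StochasticRule A) (μ : Measure (ℤ → A))
    (hμ : Kernel.Invariant φ.pca μ) (I : Finset ℤ) (x : ℤ → A) :
    μ.real {η | ∀ i ∈ I, η i = x i} =
      ∫ η, ∏ i ∈ I, φ.prob (η i) (η (i + 1)) (x i) ∂μ := by
  have hset : {η : ℤ → A | ∀ i ∈ I, η i = x i} = Set.pi (I : Set ℤ) fun i => {x i} := by
    ext η; simp [Set.mem_pi]
  have hms : MeasurableSet {η : ℤ → A | ∀ i ∈ I, η i = x i} := by
    rw [hset]
    exact MeasurableSet.pi I.countable_toSet fun i _ => MeasurableSet.of_discrete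
  have hlaw : ∀ η, φ.pca η {η | ∀ i ∈ I, η i = x i} =
      ENNReal.ofReal (∏ i ∈ I, φ.prob (η i) (η (i + 1)) (x i)) := by
    intro η
    change φ.updateLaw η _ = _
    rw [hset, StochasticRule.updateLaw, Measure.infinitePi_pi _ (fun i _ => MeasurableSet.of_discrete),
      ENNReal.ofReal_prod_of_nonneg (fun i _ => φ.prob_nonneg _ _ _)]
    refine Finset.prod_congr rfl fun i _ => ?_
    rw [PMF.toMeasure_apply_singleton _ _ MeasurableSet.of_discrete]
    rfl
  have hmeas : Measurable fun η : ℤ → A => ∏ i ∈ I, φ.prob (η i) (η (i + 1)) (x i) := by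
    refine Finset.measurable_fun_prod I fun i _ => ?_
    have hg : Measurable (fun z : A × A => φ.prob z.1 z.2 (x i)) := measurable_of_countable _
    have hp : Measurable fun η : ℤ → A => (η i, η (i + 1)) :=
      (measurable_pi_apply i).prodMk (measurable_pi_apply (i + 1))
    exact hg.comp hp
  rw [integral_eq_lintegral_of_nonneg_ae
    (Filter.Eventually.of_forall fun η => Finset.prod_nonneg fun i _ => φ.prob_nonneg _ _ _)
    hmeas.aestronglyMeasurable, measureReal_def]
  congr 1
  conv_lhs => rw [← hμ.def, Measure.bind_apply hms φ.pca.measurable.aemeasurable]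
  exact lintegral_congr hlaw

/-- The probability of the word `abce`. -/
noncomputable def quadProb (μ : Measure (ℤ → Symb)) (a b c e : Symb) : ℝ :=
  μ.real {η | η 0 = a ∧ η 1 = b ∧ η 2 = c ∧ η 3 = e}

/-- The expectation of a function of four consecutive cells. -/
theorem integral_four_cells (μ : Measure (ℤ → Symb)) [IsProbabilityMeasure μ]
    (g : Symb → Symb → Symb → Symb → ℝ) :
    ∫ η, g (η 0) (η 1) (η 2) (η 3) ∂μ =
      ∑ a, ∑ b, ∑ c, ∑ e, quadProb μ a b c e * g a b c e := by
  let π : (ℤ → Symb) → Symb × Symb × Symb × Symb := fun η => (η 0, η 1, η 2, η 3)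
  have hπ : Measurable π := by fun_prop
  have h1 : ∫ η, g (η 0) (η 1) (η 2) (η 3) ∂μ =
      ∫ z, g z.1 z.2.1 z.2.2.1 z.2.2.2 ∂(μ.map π) := by
    rw [integral_map hπ.aemeasurable (measurable_of_countable _).aestronglyMeasurable]
  have : IsProbabilityMeasure (μ.map π) := Measure.isProbabilityMeasure_map hπ.aemeasurable
  rw [h1, integral_fintype (Integrable.of_finite)]
  simp only [Fintype.sum_prod_type, smul_eq_mul]
  refine Finset.sum_congr rfl fun a _ => Finset.sum_congr rfl fun b _ =>
    Finset.sum_congr rfl fun c _ => Finset.sum_congr rfl fun e _ => ?_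
  congr 1
  rw [quadProb, map_measureReal_apply hπ MeasurableSet.of_discrete]
  congr 1
  ext η
  simp [π]

/-! ### Symmetries of word probabilities. -/

theorem measurable_shiftConf (y : ℤ) : Measurable (shiftConf y) :=
  measurable_pi_lambda _ fun x => measurable_pi_apply (x + y)

theorem measurable_reflectConf : Measurable reflectConf :=
  measurable_pi_lambda _ fun x => measurable_pi_apply (-x)

theorem TranslationInvariant.measureReal_preimage {μ : Measure (ℤ → Symb)}
    (hT : TranslationInvariant μ) (y : ℤ) {B : Set (ℤ → Symb)} (hB : MeasurableSet B) :
    μ.real (shiftConf y ⁻¹' B) = μ.real B := by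
  have hsurj : Function.Surjective (shiftConf y) := fun η =>
    ⟨shiftConf (-y) η, by funext x; simp [shiftConf]⟩
  rw [measureReal_def, hT y _ (measurable_shiftConf y hB), Set.image_preimage_eq _ hsurj,
    measureReal_def]

theorem ReflectionInvariant.measureReal_preimage {μ : Measure (ℤ → Symb)}
    (hR : ReflectionInvariant μ) {B : Set (ℤ → Symb)} (hB : MeasurableSet B) :
    μ.real (reflectConf ⁻¹' B) = μ.real B := by
  have hsurj : Function.Surjective reflectConf := fun η =>
    ⟨reflectConf η, by funext x; simp [reflectConf]⟩
  rw [measureReal_def, hR _ (measurable_reflectConf hB), Set.image_preimage_eq _ hsurj,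
    measureReal_def]

/-- The probability of the word `abc`. -/
noncomputable def tripleProb (μ : Measure (ℤ → Symb)) (a b c : Symb) : ℝ :=
  μ.real {η | η 0 = a ∧ η 1 = b ∧ η 2 = c}

theorem measurableSet_triple (i j k : ℤ) (a b c : Symb) :
    MeasurableSet {η : ℤ → Symb | η i = a ∧ η j = b ∧ η k = c} := by
  have h : ∀ (i : ℤ) (a : Symb), MeasurableSet {η : ℤ → Symb | η i = a} := fun i a =>
    measurableSet_eq_fun (measurable_pi_apply i) measurable_const
  exact (h i a).inter ((h j b).inter (h k c))

theorem measureReal_four_cells (μ : Measure (ℤ → Symb)) [IsProbabilityMeasure μ]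
    (Q : Symb → Symb → Symb → Symb → Prop) [∀ a b c e, Decidable (Q a b c e)] :
    μ.real {η | Q (η 0) (η 1) (η 2) (η 3)} =
      ∑ a, ∑ b, ∑ c, ∑ e, if Q a b c e then quadProb μ a b c e else 0 := by
  let π : (ℤ → Symb) → Symb × Symb × Symb × Symb := fun η => (η 0, η 1, η 2, η 3)
  have hπ : Measurable π := by fun_prop
  have hm : MeasurableSet {η : ℤ → Symb | Q (η 0) (η 1) (η 2) (η 3)} :=
    measurableSet_preimage (f := π) (t := {z | Q z.1 z.2.1 z.2.2.1 z.2.2.2}) hπ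
      MeasurableSet.of_discrete
  have h := integral_four_cells μ fun a b c e => if Q a b c e then (1 : ℝ) else 0
  have h2 : ∫ η, (if Q (η 0) (η 1) (η 2) (η 3) then (1 : ℝ) else 0) ∂μ =
      μ.real {η | Q (η 0) (η 1) (η 2) (η 3)} := by
    rw [← integral_indicator_one hm]
    refine integral_congr_ae (Filter.Eventually.of_forall fun η => ?_)
    simp [Set.indicator_apply]
  rw [← h2, h]
  simp

theorem tripleProb_eq_sum_right (μ : Measure (ℤ → Symb)) [IsProbabilityMeasure μ]
    (a b c : Symb) : tripleProb μ a b c = ∑ e, quadProb μ a b c e := by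
  rw [tripleProb, measureReal_four_cells μ fun a' b' c' _ => a' = a ∧ b' = b ∧ c' = c]
  simp [ite_and]

theorem tripleProb_eq_sum_left {μ : Measure (ℤ → Symb)} [IsProbabilityMeasure μ]
    (hT : TranslationInvariant μ) (a b c : Symb) :
    tripleProb μ a b c = ∑ e, quadProb μ e a b c := by
  have h := hT.measureReal_preimage 1 (measurableSet_triple 0 1 2 a b c)
  have h2 : shiftConf 1 ⁻¹' {η : ℤ → Symb | η 0 = a ∧ η 1 = b ∧ η 2 = c} =
      {η | η 1 = a ∧ η 2 = b ∧ η 3 = c} := by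
    ext η; simp [shiftConf]
  rw [tripleProb, ← h, h2,
    measureReal_four_cells μ fun _ a' b' c' => a' = a ∧ b' = b ∧ c' = c]
  simp [ite_and]

theorem tripleProb_symm {μ : Measure (ℤ → Symb)} (hT : TranslationInvariant μ)
    (hR : ReflectionInvariant μ) (a b c : Symb) : tripleProb μ a b c = tripleProb μ c b a := by
  -- Reflection puts the word on cells `0, -1, -2`; a shift by `2` returns it, reversed, to cells
  -- `0, 1, 2`.
  have h := hT.measureReal_preimage 2 (B := {η : ℤ → Symb | η (-0) = a ∧ η (-1) = b ∧ η (-2) = c})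
    (measurableSet_triple _ _ _ a b c)
  rw [tripleProb, ← hR.measureReal_preimage (measurableSet_triple 0 1 2 a b c)]
  change μ.real {η : ℤ → Symb | η (-0) = a ∧ η (-1) = b ∧ η (-2) = c} = _
  rw [← h, tripleProb]
  congr 1
  ext η
  simp [shiftConf]
  tauto

/-! ### Linear relations for three-letter words. -/

/-- The relations between the probabilities of three-letter words in a translation- and
reflection-invariant stationary law that the weight function argument uses. -/
structure IsStationaryTriple (r s : ℝ) (p : Symb → Symb → Symb → ℝ) : Prop where
  nonneg : ∀ a b c, 0 ≤ p a b c
  symm : ∀ a b c, p a b c = p c b a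
  marginal : ∀ a b, ∑ c, p a b c = ∑ c, p c a b
  single : ∀ x, ∑ b, ∑ c, p x b c = ∑ a, ∑ b, ∑ c, p a b c * bondProb r s a b x
  pair : ∀ x y, ∑ c, p x y c =
    ∑ a, ∑ b, ∑ c, p a b c * (bondProb r s a b x * bondProb r s b c y)
  triple_LWD_le : ∀ m : Symb → ℝ, (∀ a b, bondProb r s a b .L ≤ m b) →
    p .L .W .D ≤ ∑ b, ∑ c, ∑ e, p b c e * (m b * bondProb r s b c .W * bondProb r s c e .D)

/-- The `LWD` bound replaces the probability of `L` in the leftmost cell by its maximum over the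
left neighbour, which leaves a sum over three-letter words. -/
theorem isStationaryTriple_tripleProb (r s : ℝ) (h : (r, s) ∈ BondParams)
    (μ : Measure (ℤ → Symb)) [IsProbabilityMeasure μ] (hT : TranslationInvariant μ)
    (hR : ReflectionInvariant μ) (hμ : Kernel.Invariant (bondPCA r s h) μ) :
    IsStationaryTriple r s (tripleProb μ) where
  nonneg a b c := measureReal_nonneg
  symm := tripleProb_symm hT hR
  marginal a b := by
    rw [Finset.sum_congr rfl fun c _ => tripleProb_eq_sum_left hT a b c,
      Finset.sum_congr rfl fun c _ => tripleProb_eq_sum_right μ c a b, Finset.sum_comm]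
  single x := by
    have hb : (bondRule r s h).prob = bondProb r s := rfl
    have hs := measureReal_cylinder_of_invariant (bondRule r s h) μ hμ {0} fun _ => x
    simp only [Finset.mem_singleton, forall_eq, Finset.prod_singleton, zero_add] at hs
    rw [measureReal_four_cells μ fun a _ _ _ => a = x,
      integral_four_cells μ fun a b _ _ => (bondRule r s h).prob a b x] at hs
    simp only [← Finset.sum_mul] at hs
    simpa [hb, ← Finset.sum_mul, ← tripleProb_eq_sum_right] using hs
  pair x y := by
    have hb : (bondRule r s h).prob = bondProb r s := rfl
    have hs := measureReal_cylinder_of_invariant (bondRule r s h) μ hμ {0, 1}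
      fun i => if i = 0 then x else y
    simp only [Finset.mem_insert, Finset.mem_singleton, forall_eq_or_imp, forall_eq,
      Finset.prod_insert (show (0 : ℤ) ∉ ({1} : Finset ℤ) by decide), Finset.prod_singleton,
      zero_add, if_true, if_neg one_ne_zero, show (1 : ℤ) + 1 = 2 by norm_num] at hs
    rw [measureReal_four_cells μ fun a b _ _ => a = x ∧ b = y,
      integral_four_cells μ fun a b c _ =>
        (bondRule r s h).prob a b x * (bondRule r s h).prob b c y] at hs
    simp only [← Finset.sum_mul] at hs
    simpa [hb, ite_and, ← tripleProb_eq_sum_right] using hs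
  triple_LWD_le m hm := by
    have hs := measureReal_cylinder_of_invariant (bondRule r s h) μ hμ {0, 1, 2}
      fun i => if i = 0 then .L else if i = 1 then .W else .D
    have h1 : (1 : ℤ) ∉ ({2} : Finset ℤ) := by decide
    have h0 : (0 : ℤ) ∉ ({1, 2} : Finset ℤ) := by decide
    simp only [Finset.mem_insert, Finset.mem_singleton, forall_eq_or_imp, forall_eq,
      Finset.prod_insert h0, Finset.prod_insert h1, Finset.prod_singleton,
      zero_add, if_true, if_neg one_ne_zero, if_neg (show (2 : ℤ) ≠ 0 by norm_num),
      if_neg (show (2 : ℤ) ≠ 1 by norm_num), show (1 : ℤ) + 1 = 2 by norm_num,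
      show (2 : ℤ) + 1 = 3 by norm_num] at hs
    rw [integral_four_cells μ fun a b c e => (bondRule r s h).prob a b .L *
      ((bondRule r s h).prob b c .W * (bondRule r s h).prob c e .D)] at hs
    rw [tripleProb, hs]
    -- Splitting each triple by its left neighbour makes both sides sums over four-letter words,
    -- compared term by term.
    simp only [tripleProb_eq_sum_left hT, Finset.sum_mul]
    rw [Finset.sum_comm]
    refine Finset.sum_le_sum fun b _ => ?_
    rw [Finset.sum_comm]
    refine Finset.sum_le_sum fun c _ => ?_
    rw [Finset.sum_comm]
    refine Finset.sum_le_sum fun e _ => Finset.sum_le_sum fun a _ => ?_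
    rw [mul_assoc (m b)]
    refine mul_le_mul_of_nonneg_left (mul_le_mul_of_nonneg_right (hm a b) ?_) measureReal_nonneg
    exact mul_nonneg ((bondRule r s h).prob_nonneg _ _ _) ((bondRule r s h).prob_nonneg _ _ _)

/-! ### The weight function argument. -/

theorem eq_zero_of_neg_of_mul_nonneg {c x : ℝ} (hc : c < 0) (hx : 0 ≤ x) (h : 0 ≤ c * x) :
    x = 0 := by
  nlinarith

/-- Since `r ≤ 1 - s`, one has `r² ≤ r(1 - s) ≤ (1 - s)²`. The right side is the `m` fed to
`triple_LWD_le`. -/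
theorem bondProb_L_le {r s : ℝ} (hr : 0 ≤ r) (hrs : r + s ≤ 1) (x y : Symb) :
    bondProb r s x y .L ≤ if y = .W then (1 - s) ^ 2 else r * (1 - s) := by
  have h1 : r * r ≤ r * (1 - s) := mul_le_mul_of_nonneg_left (by linarith) hr
  have h2 : r * (1 - s) ≤ (1 - s) * (1 - s) :=
    mul_le_mul_of_nonneg_right (by linarith) (by linarith)
  cases x <;> cases y <;> simp only [bondProb, if_true, if_false, reduceCtorEq] <;> linarith

/-- The weight function argument. The weight is the probability of `D`, plus `a` times that of
`WD`, plus `e` times that of `DD`, plus `b` times that of `LWD`. Its change under one step of the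
automaton is a linear combination of probabilities of three-letter words; if the coefficients have
the right signs then `D` has probability zero. -/
theorem IsStationaryTriple.eq_zero_of_weight {r s : ℝ} {p : Symb → Symb → Symb → ℝ}
    (hp : IsStationaryTriple r s p) (hr : 0 ≤ r) (hrs : r + s ≤ 1)
    {q o h P R : ℝ} (hq : q = 1 - s) (ho : o = 1 - r - s) (hh : h = 1 + r - s)
    (hP : P = 2 * s - s ^ 2) (hR : R = 1 - r * q) (a e b c₁ c₂ : ℝ) (hb : 0 ≤ b)
    (wwd : b * o * P * q ^ 3 - c₁ ≤ 0)
    (lwd : a * o * q * (R - P) + b * (o * R * q ^ 2 * r - 1) - c₁ ≤ 0)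
    (dwd : b * o * P * r * q ^ 2 + e * o ^ 2 * q ^ 2 - c₁ ≤ 0)
    (wld : b * r * o * R * q ^ 2 - c₂ ≤ 0)
    (lld : a * r * o * (1 - r ^ 2 - R) + b * r ^ 2 * o * (1 - r ^ 2) * q - c₂ ≤ 0)
    (dld : b * r ^ 2 * o * R * q + e * r ^ 2 * o ^ 2 - c₂ ≤ 0)
    (wdw : 2 * o * q - 1 + a * (2 * P * o * q - 1) + c₁ + b * P * q ^ 3 * o + e * o ^ 2 * q ^ 2 < 0)
    (wdl : 2 * o * q - 1 + (2 * r * o - 1)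
      + a * (2 * P * o * q - 1 + o * q * (R - P) + r * o * (R + P)) + c₁ + c₂
      + b * (P * q ^ 2 * o * r + R * q ^ 2 * r * o) + 2 * e * o ^ 2 * q * r < 0)
    (wdd : 2 * o * q - 1 + (o * h - 1) + a * (2 * P * o * q - 1 + o * h * P) + c₁
      + b * (P * q ^ 2 * o * h + P * r * q ^ 2 * o) + e * (2 * o ^ 2 * q * h - 1) < 0)
    (ldl : 2 * r * o - 1 + a * (2 * r * o * R) + c₂ + b * R * q * r ^ 2 * o
      + e * r ^ 2 * o ^ 2 < 0)
    (ldd : 2 * r * o - 1 + (o * h - 1) + a * (o * h * R + r * o * (R + P)) + c₂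
      + b * (R * q * r * o * h + P * r ^ 2 * q * o) + e * (2 * o ^ 2 * r * h - 1) < 0)
    (ddd : o * h - 1 + a * o * h * P + b * P * r * q * o * h + e * (h ^ 2 * o ^ 2 - 1) < 0) :
    ∑ y, ∑ z, p .D y z = 0 := by
  have E1 := hp.single .D
  have E2 := hp.pair .W .D
  have E4 := hp.pair .D .D
  have M1 := hp.marginal .W .D
  have M2 := hp.marginal .L .D
  have I3 := hp.triple_LWD_le (fun x => if x = .W then (1 - s) ^ 2 else r * (1 - s)) (bondProb_L_le hr hrs)
  rw [sum_symb]
  simp only [sum_symb, bondProb, mul_zero, zero_mul, add_zero, zero_add, reduceCtorEq, if_true,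
    if_false, hp.symm .D .W .W, hp.symm .D .W .L, hp.symm .D .L .W, hp.symm .D .L .L,
    hp.symm .D .D .W, hp.symm .D .D .L, hp.symm .L .D .W] at E1 E2 E4 M1 M2 I3 ⊢
  -- `LWD` enters through an inequality only, hence `0 ≤ b`; `a` and `e` may have either sign.
  have key := mul_nonneg hb (sub_nonneg.2 I3)
  have total : 0 ≤ (b * o * P * q ^ 3 - c₁) * p .W .W .D +
      (a * o * q * (R - P) + b * (o * R * q ^ 2 * r - 1) - c₁) * p .L .W .D +
      (b * o * P * r * q ^ 2 + e * o ^ 2 * q ^ 2 - c₁) * p .D .W .D +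
      (b * r * o * R * q ^ 2 - c₂) * p .W .L .D +
      (a * r * o * (1 - r ^ 2 - R) + b * r ^ 2 * o * (1 - r ^ 2) * q - c₂) * p .L .L .D +
      (b * r ^ 2 * o * R * q + e * r ^ 2 * o ^ 2 - c₂) * p .D .L .D +
      (2 * o * q - 1 + a * (2 * P * o * q - 1) + c₁ + b * P * q ^ 3 * o + e * o ^ 2 * q ^ 2) * p .W .D .W +
      (2 * o * q - 1 + (2 * r * o - 1) + a * (2 * P * o * q - 1 + o * q * (R - P) + r * o * (R + P)) + c₁ + c₂ + b * (P * q ^ 2 * o * r + R * q ^ 2 * r * o) + 2 * e * o ^ 2 * q * r) * p .W .D .L +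
      (2 * o * q - 1 + (o * h - 1) + a * (2 * P * o * q - 1 + o * h * P) + c₁ + b * (P * q ^ 2 * o * h + P * r * q ^ 2 * o) + e * (2 * o ^ 2 * q * h - 1)) * p .W .D .D +
      (2 * r * o - 1 + a * (2 * r * o * R) + c₂ + b * R * q * r ^ 2 * o + e * r ^ 2 * o ^ 2) * p .L .D .L +
      (2 * r * o - 1 + (o * h - 1) + a * (o * h * R + r * o * (R + P)) + c₂ + b * (R * q * r * o * h + P * r ^ 2 * q * o) + e * (2 * o ^ 2 * r * h - 1)) * p .L .D .D +
      (o * h - 1 + a * o * h * P + b * P * r * q * o * h + e * (h ^ 2 * o ^ 2 - 1)) * p .D .D .D := by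
    -- The multipliers of `M1` and `M2` move the part common to the words `xWD` (resp. `xLD`) onto
    -- the words `WDx` (resp. `LDx`); `c₁` and `c₂` are the free amounts in this exchange.
    subst hR hq ho hh hP
    linear_combination key + E1 + a * E2 + e * E4 +
      (1 - (1 - r - s) * (1 - s) * (1 + a * (2 * s - s ^ 2)) - c₁) * M1 +
      (1 - r * (1 - r - s) * (1 + a * (1 - r * (1 - s))) - c₂) * M2
  have nwdw := hp.nonneg .W .D .W
  have nwdl := hp.nonneg .W .D .L
  have nwdd := hp.nonneg .W .D .D
  have nldl := hp.nonneg .L .D .L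
  have nldd := hp.nonneg .L .D .D
  have nddd := hp.nonneg .D .D .D
  have mwdw := mul_nonpos_of_nonpos_of_nonneg wdw.le nwdw
  have mwdl := mul_nonpos_of_nonpos_of_nonneg wdl.le nwdl
  have mwdd := mul_nonpos_of_nonpos_of_nonneg wdd.le nwdd
  have mldl := mul_nonpos_of_nonpos_of_nonneg ldl.le nldl
  have mldd := mul_nonpos_of_nonpos_of_nonneg ldd.le nldd
  have mddd := mul_nonpos_of_nonpos_of_nonneg ddd.le nddd
  have mwwd := mul_nonpos_of_nonpos_of_nonneg wwd (hp.nonneg .W .W .D)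
  have mlwd := mul_nonpos_of_nonpos_of_nonneg lwd (hp.nonneg .L .W .D)
  have mdwd := mul_nonpos_of_nonpos_of_nonneg dwd (hp.nonneg .D .W .D)
  have mwld := mul_nonpos_of_nonpos_of_nonneg wld (hp.nonneg .W .L .D)
  have mlld := mul_nonpos_of_nonpos_of_nonneg lld (hp.nonneg .L .L .D)
  have mdld := mul_nonpos_of_nonpos_of_nonneg dld (hp.nonneg .D .L .D)
  have zwdw := eq_zero_of_neg_of_mul_nonneg wdw nwdw (by linarith)
  have zwdl := eq_zero_of_neg_of_mul_nonneg wdl nwdl (by linarith)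
  have zwdd := eq_zero_of_neg_of_mul_nonneg wdd nwdd (by linarith)
  have zldl := eq_zero_of_neg_of_mul_nonneg ldl nldl (by linarith)
  have zldd := eq_zero_of_neg_of_mul_nonneg ldd nldd (by linarith)
  have zddd := eq_zero_of_neg_of_mul_nonneg ddd nddd (by linarith)
  -- `M1` and `M2` reduce the words `DWx` and `DLx`, read backwards, to words with middle letter
  -- `D`.
  linarith

/-! ### Weights for the three regimes. -/

/-- The probability of `D` alone is a weight that decreases when `2(1 - r - s)(1 - s) < 1`. -/
theorem IsStationaryTriple.eq_zero_of_two_mul_lt {r s : ℝ} {p : Symb → Symb → Symb → ℝ}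
    (hp : IsStationaryTriple r s p) (hr : 0 ≤ r) (hs : 0 ≤ s) (hrs : r + s ≤ 1)
    (h : 2 * (1 - r - s) * (1 - s) < 1) : ∑ y, ∑ z, p .D y z = 0 := by
  have h1 : 2 * r * (1 - r - s) < 1 := by nlinarith [sq_nonneg (r - (1 - r - s))]
  have h2 : (1 - r - s) * (1 + r - s) < 1 := by nlinarith [mul_nonneg hs hr]
  apply hp.eq_zero_of_weight hr hrs rfl rfl rfl rfl rfl 0 0 0 0 0 le_rfl <;> linarith

theorem IsStationaryTriple.eq_zero_of_no_targets {r : ℝ} {p : Symb → Symb → Symb → ℝ}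
    (hp : IsStationaryTriple r 0 p) (hr : 0.157175 ≤ r) (hr' : r ≤ 1) :
    ∑ y, ∑ z, p .D y z = 0 := by
  rcases le_or_gt r (31 / 100) with h | h
  -- All coefficients have degree at most 6 in `r`, so `linarith` can certify their signs in the
  -- degree 6 Bernstein basis of the interval.
  · have T : ∀ i j : ℕ, 0 ≤ (r - 0.157175) ^ i * (31 / 100 - r) ^ j := fun i j =>
      mul_nonneg (pow_nonneg (by linarith) i) (pow_nonneg (by linarith) j)
    apply hp.eq_zero_of_weight (by linarith) (by linarith) rfl rfl rfl rfl rfl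
      -- This `a` makes the `wdw` coefficient equal to `-r²/50`, and this `c₂` makes `wld` vanish.
      -- At the left endpoint `lwd`, `wdd` and `ldd` are nearly zero.
      (1 - 2 * r - (1 - r) ^ 2 / 3 + r ^ 2 / 50) (-1 / 3) (36 / 100) 0
      (36 / 100 * (1 - r) ^ 2 * r) (by norm_num) <;>
    linarith [T 6 0, T 5 1, T 4 2, T 3 3, T 2 4, T 1 5, T 0 6]
  rcases le_or_gt r (6 / 10) with h' | h'
  · have T : ∀ i j : ℕ, 0 ≤ (r - 31 / 100) ^ i * (6 / 10 - r) ^ j := fun i j =>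
      mul_nonneg (pow_nonneg (by linarith) i) (pow_nonneg (by linarith) j)
    apply hp.eq_zero_of_weight (by linarith) (by linarith) rfl rfl rfl rfl rfl
      (4 / 10) 0 (23 / 100) 0 (5 / 100) (by norm_num) <;>
    linarith [T 6 0, T 5 1, T 4 2, T 3 3, T 2 4, T 1 5, T 0 6]
  · exact hp.eq_zero_of_two_mul_lt (by linarith) le_rfl (by linarith) (by linarith)

theorem IsStationaryTriple.eq_zero_of_traps_eq_targets {r : ℝ} {p : Symb → Symb → Symb → ℝ}
    (hp : IsStationaryTriple r r p) (hr : 0.10883 ≤ r) (hr' : r + r ≤ 1) :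
    ∑ y, ∑ z, p .D y z = 0 := by
  rcases le_or_gt r (2 / 10) with h | h
  · have T : ∀ i j : ℕ, 0 ≤ (r - 0.10883) ^ i * (2 / 10 - r) ^ j := fun i j =>
      mul_nonneg (pow_nonneg (by linarith) i) (pow_nonneg (by linarith) j)
    apply hp.eq_zero_of_weight (by linarith) (by linarith) rfl rfl rfl rfl rfl
      -- `c₁` and `c₂` are chosen so that `wwd` and `wld` vanish.
      (7 / 10) 0 (33 / 100)
      (33 / 100 * (1 - r - r) * (2 * r - r ^ 2) * (1 - r) ^ 3)
      (33 / 100 * r * (1 - r - r) * (1 - r * (1 - r)) * (1 - r) ^ 2) (by norm_num) <;>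
    linarith [T 6 0, T 5 1, T 4 2, T 3 3, T 2 4, T 1 5, T 0 6]
  · exact hp.eq_zero_of_two_mul_lt (by linarith) (by linarith) (by linarith)
      (by nlinarith)

/-- With `P = 2s - s²`, the weight with `a = 1 + 3P - 2r`, `e = P`, `b = 1` decreases for small `s`
and `r ≤ 4P²/5`: its coefficients are negative to leading order in `s`, where `r = 4us²`. -/
theorem IsStationaryTriple.eq_zero_of_small {r s : ℝ} {p : Symb → Symb → Symb → ℝ}
    (hp : IsStationaryTriple r s p) (hr : 0 ≤ r) (hs : 0 < s) (hs' : s ≤ 1 / 1000)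
    (hrs : r ≤ 8 / 10 * (2 * s - s ^ 2) ^ 2) : ∑ y, ∑ z, p .D y z = 0 := by
  obtain ⟨u, rfl⟩ : ∃ u, r = 4 * u * s ^ 2 := ⟨r / (4 * s ^ 2), by field_simp⟩
  have hs2 : 0 < s ^ 2 := by positivity
  have hu : 0 ≤ u := by nlinarith
  have hu8 : u ≤ 8 / 10 := by
    have h1 : (2 * s - s ^ 2) ^ 2 ≤ 4 * s ^ 2 := by nlinarith [pow_pos hs 3]
    by_contra! h2
    nlinarith
  -- Each coefficient is a polynomial in `s` and `u`. Beyond the leading order, `N` discards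
  -- negative monomials and `U` bounds positive ones by a power of `s`.
  have N : ∀ n j : ℕ, 0 ≤ s ^ n * u ^ j := fun n j => by positivity
  have U : ∀ m n j : ℕ, m ≤ n → s ^ n * u ^ j ≤ s ^ m := fun m n j hmn =>
    (mul_le_of_le_one_right (by positivity) (pow_le_one₀ hu (by linarith))).trans
      (pow_le_pow_of_le_one hs.le (by linarith) hmn)
  -- `lld` and `dld` have leading term `-4us²`, which may vanish with `u`, so their errors are
  -- measured against `s²u`.
  have V : ∀ n j : ℕ, 3 ≤ n → 1 ≤ j → s ^ n * u ^ j ≤ 1 / 1000 * (s ^ 2 * u) := by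
    intro n j hn hj
    have h1 : s ^ n ≤ s ^ 3 := pow_le_pow_of_le_one hs.le (by linarith) hn
    have h2 : u ^ j ≤ u := pow_le_of_le_one hu (by linarith) (by omega)
    calc s ^ n * u ^ j ≤ s ^ 3 * u := mul_le_mul h1 h2 (pow_nonneg hu j) (by positivity)
      _ = s * (s ^ 2 * u) := by ring
      _ ≤ _ := mul_le_mul_of_nonneg_right hs' (by positivity)
  have hus : u * s ^ 2 ≤ 8 / 10 * s ^ 2 := mul_le_mul_of_nonneg_right hu8 hs2.le
  have hr1 : 4 * u * s ^ 2 ≤ 1 / 1000 := by nlinarith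
  have p2 : s ^ 2 ≤ 1 / 1000 * s := by nlinarith
  have p3 : s ^ 3 ≤ 1 / 1000 * s ^ 2 := by nlinarith
  have p4 : s ^ 4 ≤ 1 / 1000 * s ^ 3 := by nlinarith [pow_pos hs 3]
  have hs3 : 0 < s ^ 3 := by positivity
  -- `c₁` and `c₂` annul `wwd` and `wld`; with `r + o = q`, `e = P` annuls `dwd`. The choice of `a`
  -- cancels the lower orders, leaving `-12(1+u)s²` in `lwd`, `-8s²` in `wdw` and `wdd`, `(8u-12)s²`
  -- in `ldd` and `-(16+8u)s³` in `ddd`; `wdl` and `ldl` start at `-2s` and `-1`.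
  apply hp.eq_zero_of_weight hr (by linarith) rfl rfl rfl rfl rfl
    (1 + 3 * (2 * s - s ^ 2) - 2 * (4 * u * s ^ 2)) (2 * s - s ^ 2) 1
    ((1 - 4 * u * s ^ 2 - s) * (2 * s - s ^ 2) * (1 - s) ^ 3)
    (4 * u * s ^ 2 * (1 - 4 * u * s ^ 2 - s) * (1 - 4 * u * s ^ 2 * (1 - s)) * (1 - s) ^ 2)
    zero_le_one
  · apply le_of_eq; ring
  · linarith [U 3 3 1 (by norm_num), N 4 0, U 3 4 1 (by norm_num), U 3 4 2 (by norm_num), U 3 5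
      0 (by norm_num), N 5 1, N 5 2, N 6 0, U 3 6 1 (by norm_num), N 6 2, N 6 3, N 7 1, U 3
      7 2 (by norm_num), U 3 7 3 (by norm_num), N 8 2, U 3 8 3 (by norm_num), N 9 3]
  · apply le_of_eq; ring
  · apply le_of_eq; ring
  · linarith [V 3 1 (by norm_num) (by norm_num), N 4 1, V 4 2 (by norm_num) (by norm_num), V 5 1
      (by norm_num) (by norm_num), N 5 2, N 6 2, N 6 3, V 7 2 (by norm_num) (by norm_num), N
      7 3, N 8 2, V 8 3 (by norm_num) (by norm_num), V 8 4 (by norm_num) (by norm_num), N 9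
      3, V 9 4 (by norm_num) (by norm_num), N 10 4, N 10 5, N 11 5]
  · linarith [V 3 1 (by norm_num) (by norm_num), N 4 1, V 4 2 (by norm_num) (by norm_num), V 5 1
      (by norm_num) (by norm_num), N 5 2, V 6 2 (by norm_num) (by norm_num), N 6 3, V 7 3
      (by norm_num) (by norm_num), V 8 4 (by norm_num) (by norm_num)]
  · linarith [N 3 1, U 3 4 0 (by norm_num), U 3 4 1 (by norm_num), N 5 0, N 5 1, U 3 5 2 (by
      norm_num), U 3 6 0 (by norm_num), N 6 1, N 6 2, U 3 7 1 (by norm_num), U 3 7 2 (by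
      norm_num), N 8 2]
  · linarith [U 2 2 1 (by norm_num), N 3 0, N 3 1, U 2 4 0 (by norm_num), U 2 4 1 (by norm_num),
      N 4 2, N 5 0, N 5 1, N 5 2, U 2 6 0 (by norm_num), U 2 6 1 (by norm_num), U 2 6 2 (by
      norm_num), U 2 6 3 (by norm_num), N 7 1, N 7 2, U 2 7 3 (by norm_num), N 8 3, N 8 4, U
      2 9 3 (by norm_num), U 2 9 4 (by norm_num)]
  · linarith [N 3 1, U 3 4 0 (by norm_num), U 3 4 1 (by norm_num), N 4 2, N 5 0, U 3 5 1 (by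
      norm_num), N 5 2, U 3 6 0 (by norm_num), N 6 1, N 6 2, U 3 7 1 (by norm_num), U 3 7 3
      (by norm_num), U 3 8 2 (by norm_num), N 8 3, U 3 9 3 (by norm_num)]
  · linarith [U 2 2 1 (by norm_num), U 2 3 1 (by norm_num), N 4 1, N 4 2, U 2 5 1 (by norm_num),
      N 5 2, U 2 6 2 (by norm_num), U 2 6 3 (by norm_num), N 7 2, N 7 3, U 2 8 2 (by
      norm_num), N 8 3, N 8 4, U 2 9 3 (by norm_num), U 2 9 4 (by norm_num)]
  · linarith [U 3 3 1 (by norm_num), N 4 0, U 3 4 1 (by norm_num), N 4 2, N 5 1, N 5 2, U 3 6 1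
      (by norm_num), U 3 6 2 (by norm_num), U 3 6 3 (by norm_num), N 7 1, U 3 7 3 (by
      norm_num), N 8 2, N 8 3, N 8 4, U 3 9 3 (by norm_num), U 3 9 4 (by norm_num), N 10 4]
  · linarith [N 3 1, U 4 4 1 (by norm_num), N 4 2, N 5 0, U 4 5 1 (by norm_num), N 5 2, U 4 6 0 (by
      norm_num), N 6 1, N 6 2, U 4 7 1 (by norm_num), U 4 7 2 (by norm_num), U 4 7 3 (by
      norm_num), N 8 2, U 4 8 3 (by norm_num), N 9 3, U 4 9 4 (by norm_num), N 10 4]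

/-- With `P = 2s - s²` and `t = r/(1-s)`, the inequality reads `3P²/2 ≥ 2t` to leading order, so `t
≤ 3P²/4`. The slack between `3/4` and `8/10` absorbs the terms `8Pt` and `11t²/2`. -/
theorem RegimeB1.le_sq {r s : ℝ} (h : RegimeB1 (1 / 1000) (1 / 1000) r s) (hr : 0 ≤ r)
    (hs : 0 ≤ s) : r ≤ 8 / 10 * (2 * s - s ^ 2) ^ 2 := by
  obtain ⟨hr', hs', hpoly⟩ := h
  have hq : 0 < 1 - s := by linarith
  obtain ⟨t, rfl⟩ : ∃ t, r = t * (1 - s) := ⟨r / (1 - s), by field_simp⟩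
  have ht : 0 ≤ t := by
    by_contra! h
    nlinarith
  have ht' : t ≤ 2 / 1000 := by nlinarith
  have e1 : ∀ x : ℝ, x * (t * (1 - s)) / (1 - s) = x * t := fun x => by field_simp
  have e2 : ∀ x : ℝ, x * (t * (1 - s)) ^ 2 / (2 * (1 - s) ^ 2) = x * t ^ 2 / 2 := fun x => by
    field_simp
  have e3 : ∀ x : ℝ, x * (t * (1 - s)) ^ 3 / (1 - s) ^ 3 = x * t ^ 3 := fun x => by field_simp
  rw [e1, e1, e1, e2, e2, e3] at hpoly
  have hP : 0 ≤ 2 * s - s ^ 2 := by nlinarith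
  have hP' : 2 * s - s ^ 2 ≤ 2 / 1000 := by nlinarith
  generalize 2 * s - s ^ 2 = P at *
  have h1 : P * t ≤ 2 / 1000 * t := mul_le_mul_of_nonneg_right hP' ht
  have h2 : t ^ 2 ≤ 2 / 1000 * t := by nlinarith
  have h3 : 0 ≤ P ^ 3 := by positivity
  have h4 : 0 ≤ P ^ 2 * t := by positivity
  have h5 : 0 ≤ P * t ^ 2 := by positivity
  have h6 : 0 ≤ t ^ 3 := by positivity
  have h7 : t * (1 - s) ≤ t := mul_le_of_le_one_right ht (by linarith)
  linarith

theorem IsStationaryTriple.eq_zero_of_regimeB1 {r s : ℝ} {p : Symb → Symb → Symb → ℝ}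
    (hp : IsStationaryTriple r s p) (h : (r, s) ∈ BondParams)
    (hB : RegimeB1 (1 / 1000) (1 / 1000) r s) : ∑ y, ∑ z, p .D y z = 0 := by
  obtain ⟨⟨hr, -⟩, ⟨hs, -⟩, hpos, -⟩ := h
  dsimp only at hr hs hpos
  have hle := hB.le_sq hr hs
  rcases hs.eq_or_lt with rfl | hs0
  -- If `s = 0` the bound forces `r ≤ 0`, and `(0, 0)` is excluded from the parameter space.
  · norm_num at hle
    linarith
  · exact hp.eq_zero_of_small hr hs0 hB.2.1 hle

/-! ### Back to the measure. -/

theorem measureReal_eq_sum_tripleProb {μ : Measure (ℤ → Symb)} [IsProbabilityMeasure μ]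
    (hT : TranslationInvariant μ) (x : ℤ) (a : Symb) :
    μ.real {η | η x = a} = ∑ b, ∑ c, tripleProb μ a b c := by
  have hm : MeasurableSet {η : ℤ → Symb | η 0 = a} :=
    measurableSet_eq_fun (measurable_pi_apply 0) measurable_const
  have h := hT.measureReal_preimage x hm
  have h2 : shiftConf x ⁻¹' {η : ℤ → Symb | η 0 = a} = {η | η x = a} := by
    ext η; simp [shiftConf]
  rw [← h2, h, measureReal_four_cells μ fun a' _ _ _ => a' = a]
  simp [← tripleProb_eq_sum_right]

theorem theorem5 :
    ∃ ε₁ ∈ Set.Ioo (0 : ℝ) 1, ∃ ε₂ ∈ Set.Ioo (0 : ℝ) 1,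
      ∀ (r s : ℝ) (h : (r, s) ∈ BondParams),
        (RegimeB1 ε₁ ε₂ r s ∨ RegimeB2 r s ∨ RegimeB3 r s) →
        ∀ (μ : MeasureTheory.Measure (ℤ → Symb)) [MeasureTheory.IsProbabilityMeasure μ],
          TranslationInvariant μ → ReflectionInvariant μ →
          ProbabilityTheory.Kernel.Invariant (bondPCA r s h) μ →
          ∀ x : ℤ, μ {η | η x = Symb.D} = 0 := by
  refine ⟨1 / 1000, by norm_num, 1 / 1000, by norm_num, ?_⟩
  intro r s h hB μ _ hT hR hμ x
  have hp := isStationaryTriple_tripleProb r s h μ hT hR hμ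
  have hzero : ∑ y, ∑ z, tripleProb μ .D y z = 0 := by
    rcases hB with hB | ⟨rfl, hr⟩ | ⟨rfl, hr⟩
    · exact hp.eq_zero_of_regimeB1 h hB
    · exact hp.eq_zero_of_no_targets hr.le h.1.2
    · exact hp.eq_zero_of_traps_eq_targets hr h.2.2.2
  rwa [← measureReal_eq_sum_tripleProb hT x, measureReal_eq_zero_iff] at hzero
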